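/- Let $\mathcal B$ be the automaton with states $q,w,e,r$ over the alphabet $\{0,1\}$ given by the wreath recursion $$q=(w,w),\qquad w=(e,q)\sigma,\qquad e=(r,r)\sigma,\qquad r=(q,e)\sigma,$$ where $\sigma$ is the transposition of $0$ and $1$. That is, for a state $s=(s_0,s_1)\tau$ and a letter $x$, the automaton in state $s$ reading $x$ outputs $\tau(x)$ and moves to state $s_x$; each state thereby acts as an automorphism of the rooted tree $\{0,1\}^*$ of finite words. Products of automorphisms are composed from left to right, $gh(u)=h(g(u))$. Let $\mathcal H$ be the group generated by $q,w,e,r$. Then $\mathcal B$ is bireversible (it is invertible, its dual is invertible, and the dual of its inverse is invertible), and: 1. every nonempty finite word over $\{q,w,e,r\}$ having none of $q^2,w^2,e^2,r^2,qe,eq,wr,rw$ as a subword (a block of two consecutive letters) represents a nontrivial element of $\mathcal H$; 2. in particular, the subsemigroup $\langle er,qr\rangle_+$ of $\mathcal H$ generated by $er$ and $qr$ is torsion-free, i.e. each of its elements has infinite order. -/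

import Mathlib

/-- A Mealy automaton with state set `Q` over the alphabet `X`: `trans` is the transition
function and `out` is the output function. -/
structure MealyAutomaton (Q X : Type*) where
  trans : Q → X → Q
  out : Q → X → X

namespace MealyAutomaton

variable {Q X : Type*}

/-- Every state acts on the alphabet by a permutation. -/
def Invertible (A : MealyAutomaton Q X) : Prop :=
  ∀ s, Function.Bijective (A.out s)

/-- The dual automaton: states and letters are exchanged, and so are `trans` and `out`. -/
def dual (A : MealyAutomaton Q X) : MealyAutomaton X Q where
  trans x s := A.out s x
  out x s := A.trans s x

/-- The permutation of the alphabet defined by a state of an invertible automaton. -/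
noncomputable def outEquiv (A : MealyAutomaton Q X) (hA : A.Invertible) (s : Q) :
    Equiv.Perm X :=
  Equiv.ofBijective (A.out s) (hA s)

/-- The inverse automaton: an arrow from `s` to `t` labelled `x|y` becomes an arrow from `s`
to `t` labelled `y|x`. -/
noncomputable def inverse (A : MealyAutomaton Q X) (hA : A.Invertible) :
    MealyAutomaton Q X where
  trans s y := A.trans s ((A.outEquiv hA s).symm y)
  out s y := (A.outEquiv hA s).symm y

/-- The automaton is reversible: its dual is invertible. -/
def Reversible (A : MealyAutomaton Q X) : Prop := A.dual.Invertible

/-- The automaton is invertible and reversible, and its inverse is reversible. -/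
def Bireversible (A : MealyAutomaton Q X) : Prop :=
  ∃ hA : A.Invertible, A.Reversible ∧ (A.inverse hA).Reversible

/-- The action of the initial automaton with initial state `s` on finite words over `X`. -/
def run (A : MealyAutomaton Q X) : Q → List X → List X
  | _, [] => []
  | s, x :: u => A.out s x :: A.run (A.trans s x) u

theorem run_injective (A : MealyAutomaton Q X) (hA : A.Invertible) (s : Q) :
    Function.Injective (A.run s) := by
  intro u
  induction u generalizing s with
  | nil => intro v h; cases v <;> simp_all [run]
  | cons x u ih =>
    intro v h
    cases v with
    | nil => simp [run] at h
    | cons y v =>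
      simp only [run, List.cons.injEq] at h
      obtain rfl := (hA s).1 h.1
      rw [ih _ h.2]

theorem run_surjective (A : MealyAutomaton Q X) (hA : A.Invertible) (s : Q) :
    Function.Surjective (A.run s) := by
  intro v
  induction v generalizing s with
  | nil => exact ⟨[], rfl⟩
  | cons y v ih =>
    obtain ⟨x, rfl⟩ := (hA s).2 y
    obtain ⟨u, rfl⟩ := ih (A.trans s x)
    exact ⟨x :: u, rfl⟩

theorem run_prefix_iff (A : MealyAutomaton Q X) (hA : A.Invertible) (s : Q) (u v : List X) :
    A.run s u <+: A.run s v ↔ u <+: v := by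
  induction u generalizing s v with
  | nil => simp [run]
  | cons x u ih =>
    cases v with
    | nil => simp [run]
    | cons y v =>
      simp only [run, List.cons_prefix_cons]
      constructor
      · rintro ⟨h, h'⟩
        obtain rfl := (hA s).1 h
        exact ⟨rfl, (ih _ _).1 h'⟩
      · rintro ⟨rfl, h'⟩
        exact ⟨rfl, (ih _ _).2 h'⟩

end MealyAutomaton

/-- The group of automorphisms of the rooted tree of finite words over `X`: the permutations of
the vertices that preserve and reflect the relation "`u` lies on the path from the root to `v`",
that is, "`u` is a prefix of `v`".  The opposite of `Equiv.Perm` is used so that in a product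
`g * h` the left factor `g` acts first, i.e. `(g * h) u = h (g u)`. -/
def treeAut (X : Type*) : Subgroup (Equiv.Perm (List X))ᵐᵒᵖ where
  carrier := {g | ∀ u v : List X, g.unop u <+: g.unop v ↔ u <+: v}
  one_mem' := fun _ _ => Iff.rfl
  mul_mem' := fun {g h} hg hh u v => (hh (g.unop u) (g.unop v)).trans (hg u v)
  inv_mem' := fun {g} hg u v => by
    have h := hg (g.unop.symm u) (g.unop.symm v)
    rw [Equiv.apply_symm_apply, Equiv.apply_symm_apply] at h
    exact h.symm

namespace MealyAutomaton

variable {Q X : Type*}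

/-- A state of an invertible automaton, viewed as an automorphism of the tree of words. -/
noncomputable def stateAut (A : MealyAutomaton Q X) (hA : A.Invertible) (s : Q) : treeAut X :=
  ⟨MulOpposite.op (Equiv.ofBijective (A.run s) ⟨A.run_injective hA s, A.run_surjective hA s⟩),
    A.run_prefix_iff hA s⟩

/-- The automaton group: the group generated by all states. -/
noncomputable def autGroup (A : MealyAutomaton Q X) (hA : A.Invertible) :
    Subgroup (treeAut X) :=
  Subgroup.closure (Set.range (A.stateAut hA))

/-- A state as an element of the automaton group. -/
noncomputable def gen (A : MealyAutomaton Q X) (hA : A.Invertible) (s : Q) : A.autGroup hA :=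
  ⟨A.stateAut hA s, Subgroup.subset_closure ⟨s, rfl⟩⟩

/-- The element of the automaton group represented by a word over the set of states. -/
noncomputable def wordElem (A : MealyAutomaton Q X) (hA : A.Invertible) (v : List Q) :
    A.autGroup hA :=
  (v.map (A.gen hA)).prod

end MealyAutomaton

/-- The four states of the automaton generating the group `H`. -/
inductive HState
  | q | w | e | r

namespace HState

/-- The automaton over the alphabet `{0, 1}` with wreath recursion
`q = (w, w)`, `w = (e, q)σ`, `e = (r, r)σ`, `r = (q, e)σ`, where `σ` exchanges `0` and `1`. -/
def automaton : MealyAutomaton HState (Fin 2) where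
  trans
    | q => ![w, w]
    | w => ![e, q]
    | e => ![r, r]
    | r => ![q, e]
  out
    | q => id
    | w => Equiv.swap 0 1
    | e => Equiv.swap 0 1
    | r => Equiv.swap 0 1

theorem automaton_invertible : automaton.Invertible := by
  intro s
  cases s
  · exact Function.bijective_id
  all_goals exact (Equiv.swap (0 : Fin 2) 1).bijective

/-- The group `H` generated by the automaton. -/
noncomputable abbrev groupH : Subgroup (treeAut (Fin 2)) :=
  automaton.autGroup automaton_invertible

/-- The element of `H` represented by a word over `{q, w, e, r}`. -/
noncomputable abbrev elemH (v : List HState) : groupH :=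
  automaton.wordElem automaton_invertible v

/-- The forbidden words `q²`, `w²`, `e²`, `r²`, `qe`, `eq`, `wr`, `rw`. -/
def forbidden : Set (List HState) :=
  {[q, q], [w, w], [e, e], [r, r], [q, e], [e, q], [w, r], [r, w]}

end HState

/-! Words without forbidden blocks alternate between the classes `{q, e}` and `{w, r}`. Give each
state and each letter a coordinate in the two-element field, and collect the odd and even places of
a word into power series `U`, `V`. With `G = 1/(1-X)`, taking sections is affine in `(U, V)`
(`wordTrans_seriesWord`), and the output of a word depends on one coefficient of `G * U`
(`wordOut_seriesWord`). If a word of length `n + 1` is trivial, so are its iterated sections, so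
that coefficient is constant on them. Differences then show that `f = coeff k (G * ·.1)`, `k = n /
2`, vanishes on all `L ^ j (G, 0)`, where `L` is the linear part of two steps. But `L ^ 2 + 1 = X G
^ 2 L`, and applying `(L ^ 2 + 1) ^ k` to `(G, 0)` gives a vector on which `f` is 1. Products of
`er` and `qr` alternate, so no power of one is trivial. -/

/-! ### Power series over the two-element field -/

/-- The geometric series over the field with two elements. -/
noncomputable def geomSeries : PowerSeries (ZMod 2) := PowerSeries.mk 1

/-- The series obtained by removing the constant coefficient and shifting. -/
noncomputable def seriesTail (U : PowerSeries (ZMod 2)) : PowerSeries (ZMod 2) :=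
  PowerSeries.mk fun i => PowerSeries.coeff (i + 1) U

open PowerSeries

theorem seriesTail_spec (U : PowerSeries (ZMod 2)) :
    U = X * seriesTail U + C (constantCoeff U) :=
  eq_X_mul_shift_add_const U

theorem seriesTail_X_mul_add_C (U : PowerSeries (ZMod 2)) (a : ZMod 2) :
    seriesTail (X * U + C a) = U := by
  ext i
  simp [seriesTail, coeff_succ_X_mul]

theorem geomSeries_eq : geomSeries = 1 + X * geomSeries := by
  have h : geomSeries * (1 - X) = 1 := mk_one_mul_one_sub_eq_one (ZMod 2)
  linear_combination h

theorem constantCoeff_geomSeries : constantCoeff geomSeries = 1 := by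
  simp [geomSeries, ← coeff_zero_eq_constantCoeff_apply]

theorem series_two : (2 : PowerSeries (ZMod 2)) = 0 := by
  have h : (2 : ZMod 2) = 0 := rfl
  rw [← map_ofNat (C (R := ZMod 2)) 2, h, map_zero]

theorem coeff_succ_geomSeries_mul (k : ℕ) (U : PowerSeries (ZMod 2)) :
    coeff (k + 1) (geomSeries * U) =
      constantCoeff U + coeff k (geomSeries * seriesTail U) := by
  have h : geomSeries * U =
      X * (geomSeries * seriesTail U) + geomSeries * C (constantCoeff U) := by
    conv_lhs => rw [seriesTail_spec U]
    ring
  rw [h, map_add, coeff_succ_X_mul, coeff_mul_C]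
  simp [geomSeries, add_comm]

namespace HState

/-! ### Words over the states and their coordinates -/

/-- The two classes `{q, e}` and `{w, r}` of states, adjacent letters of a word without
forbidden subwords being in different classes. -/
def part : HState → Bool
  | q => false
  | e => false
  | w => true
  | r => true

/-- Words whose letters alternate between the two classes, the first class being given. -/
def Alternating : Bool → List HState → Prop
  | _, [] => True
  | p, s :: v => s.part = p ∧ Alternating (!p) v

/-- The state of the given class with the given coordinate. -/
def ofBit : Bool → ZMod 2 → HState
  | false, b => if b = 0 then q else e
  | true, b => if b = 0 then w else r

/-- The input letter with the given coordinate. -/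
def inputLetter (y : ZMod 2) : Fin 2 := if y = 0 then 1 else 0

/-- The section of a word over the states at a letter: the action of the dual automaton. -/
def wordTrans : List HState → Fin 2 → List HState
  | [], _ => []
  | s :: v, x => automaton.trans s x :: wordTrans v (automaton.out s x)

/-- The action of a word over the states on the alphabet. -/
def wordOut : List HState → Fin 2 → Fin 2
  | [], x => x
  | s :: v, x => wordOut v (automaton.out s x)

/-- The action of a word over the states on words over the alphabet. -/
def wordRun : List HState → List (Fin 2) → List (Fin 2)
  | [], u => u
  | s :: v, u => wordRun v (automaton.run s u)

theorem wordRun_cons (v : List HState) (x : Fin 2) (u : List (Fin 2)) :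
    wordRun v (x :: u) = wordOut v x :: wordRun (wordTrans v x) u := by
  induction v generalizing x u with
  | nil => rfl
  | cons s v ih => simp only [wordRun, MealyAutomaton.run, ih, wordOut, wordTrans]

theorem elemH_cons (s : HState) (v : List HState) :
    elemH (s :: v) = elemH [s] * elemH v := by
  simp [elemH, MealyAutomaton.wordElem]

theorem elemH_append (v v' : List HState) : elemH (v ++ v') = elemH v * elemH v' := by
  simp [elemH, MealyAutomaton.wordElem]

theorem elemH_apply (v : List HState) (u : List (Fin 2)) :
    (elemH v : treeAut (Fin 2)).1.unop u = wordRun v u := by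
  induction v generalizing u with
  | nil => simp [elemH, MealyAutomaton.wordElem, wordRun]
  | cons s v ih =>
    rw [elemH_cons]
    simp only [Subgroup.coe_mul, MulOpposite.unop_mul, Equiv.Perm.mul_apply, ih, wordRun]
    simp only [elemH, MealyAutomaton.wordElem, MealyAutomaton.gen, MealyAutomaton.stateAut,
      List.map_cons, List.map_nil, List.prod_cons, List.prod_nil, mul_one]
    rfl

theorem wordRun_eq_of_elemH_eq_one {v : List HState} (h : elemH v = 1) (u : List (Fin 2)) :
    wordRun v u = u := by
  rw [← elemH_apply, h]
  rfl

theorem wordOut_eq {v : List HState} (h : ∀ u, wordRun v u = u) (x : Fin 2) :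
    wordOut v x = x := by
  have := h [x]
  rw [wordRun_cons] at this
  exact (List.cons.inj this).1

theorem wordRun_wordTrans {v : List HState} (h : ∀ u, wordRun v u = u) (x : Fin 2)
    (u : List (Fin 2)) : wordRun (wordTrans v x) u = u := by
  have := h (x :: u)
  rw [wordRun_cons] at this
  exact (List.cons.inj this).2

/-- The alternating word of given length and first class, whose coordinates at odd places are
the coefficients of the first series and at even places those of the second one. -/
noncomputable def seriesWord : ℕ → Bool → PowerSeries (ZMod 2) → PowerSeries (ZMod 2) →
    List HState
  | 0, _, _, _ => []
  | n + 1, p, U, V => ofBit p (constantCoeff U) :: seriesWord n (!p) V (seriesTail U)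

theorem exists_ofBit (s : HState) : ∃ b, s = ofBit s.part b := by
  cases s
  · exact ⟨0, rfl⟩
  · exact ⟨0, rfl⟩
  · exact ⟨1, rfl⟩
  · exact ⟨1, rfl⟩

theorem Alternating.exists_seriesWord {v : List HState} {p : Bool} (h : Alternating p v) :
    ∃ U V, v = seriesWord v.length p U V := by
  induction v generalizing p with
  | nil => exact ⟨0, 0, rfl⟩
  | cons s v ih =>
    obtain ⟨rfl, h⟩ := h
    obtain ⟨U, V, hv⟩ := ih h
    obtain ⟨b, hb⟩ := exists_ofBit s
    refine ⟨X * V + C b, U, ?_⟩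
    simp only [List.length_cons, seriesWord, seriesTail_X_mul_add_C]
    rw [← hv]
    simpa using hb

/-- With the reversed coding of letters, transitions and outputs are affine in the coordinates. -/
theorem trans_ofBit_false (b y : ZMod 2) :
    automaton.trans (ofBit false b) (inputLetter y) = ofBit true b := by
  fin_cases b <;> fin_cases y <;> rfl

theorem out_ofBit_false (b y : ZMod 2) :
    automaton.out (ofBit false b) (inputLetter y) = inputLetter (y + b) := by
  fin_cases b <;> fin_cases y <;> rfl

theorem trans_ofBit_true (b y : ZMod 2) :
    automaton.trans (ofBit true b) (inputLetter y) = ofBit false (b + y) := by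
  fin_cases b <;> fin_cases y <;> rfl

theorem out_ofBit_true (b y : ZMod 2) :
    automaton.out (ofBit true b) (inputLetter y) = inputLetter (y + 1) := by
  fin_cases b <;> fin_cases y <;> rfl

theorem inputLetter_injective : Function.Injective inputLetter := by decide

/-- Only the class `true` places change class by absorbing the current letter. That letter is `y`,
plus the earlier class `false` coordinates (a factor `G`), plus the number of earlier class `true`
places (the term `X G ^ 2`). -/
theorem wordTrans_seriesWord (n : ℕ) (U V : PowerSeries (ZMod 2)) (y : ZMod 2) :
    wordTrans (seriesWord n false U V) (inputLetter y) = seriesWord n true U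
      (V + geomSeries * U + C y * geomSeries + X * geomSeries ^ 2) ∧
    wordTrans (seriesWord n true U V) (inputLetter y) = seriesWord n false
      (U + X * geomSeries * V + C y * geomSeries + X * geomSeries ^ 2) V := by
  induction n generalizing U V y with
  | zero => exact ⟨rfl, rfl⟩
  | succ n ih =>
    constructor
    · simp only [seriesWord, wordTrans, trans_ofBit_false, out_ofBit_false, Bool.not_false,
        Bool.not_true, (ih _ _ _).2]
      congr 2
      conv_rhs => rw [seriesTail_spec U]
      rw [map_add]
      ring
    · have key : U + X * geomSeries * V + C y * geomSeries + X * geomSeries ^ 2 =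
          X * (seriesTail U + geomSeries * V + C (y + 1) * geomSeries + X * geomSeries ^ 2) +
            C (constantCoeff U + y) := by
        conv_lhs => rw [seriesTail_spec U]
        simp only [map_add, map_one]
        linear_combination (C y + X * geomSeries) * geomSeries_eq
      rw [key]
      simp only [seriesWord, wordTrans, trans_ofBit_true, out_ofBit_true, Bool.not_false,
        Bool.not_true, (ih _ _ _).1, seriesTail_X_mul_add_C]
      simp

theorem wordOut_seriesWord (n : ℕ) : ∃ c, ∀ (U V : PowerSeries (ZMod 2)) (y : ZMod 2),
    wordOut (seriesWord (n + 1) false U V) (inputLetter y) =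
      inputLetter (y + coeff (n / 2) (geomSeries * U) + c) := by
  induction n using Nat.twoStepInduction with
  | zero =>
    refine ⟨0, fun U V y => ?_⟩
    simp [seriesWord, wordOut, out_ofBit_false, constantCoeff_geomSeries]
  | one =>
    refine ⟨1, fun U V y => ?_⟩
    simp [seriesWord, wordOut, out_ofBit_false, out_ofBit_true, constantCoeff_geomSeries]
  | more n ih _ =>
    obtain ⟨c, hc⟩ := ih
    refine ⟨c + 1, fun U V y => ?_⟩
    have h : wordOut (seriesWord (n + 2 + 1) false U V) (inputLetter y) =
        wordOut (seriesWord (n + 1) false (seriesTail U) (seriesTail V))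
          (inputLetter (y + constantCoeff U + 1)) := by
      rw [← out_ofBit_true (constantCoeff V), ← out_ofBit_false]
      rfl
    rw [h, hc, Nat.add_div_right _ two_pos, coeff_succ_geomSeries_mul]
    congr 1
    ring

/-! ### The affine dual action and nontriviality -/

/-- The linear part of the action of a two-letter word on the coordinates of an alternating
word. -/
noncomputable def dualLinear :
    Module.End (PowerSeries (ZMod 2)) (PowerSeries (ZMod 2) × PowerSeries (ZMod 2)) where
  toFun Z := (Z.1 + X * geomSeries * (Z.2 + geomSeries * Z.1), Z.2 + geomSeries * Z.1)
  map_add' Z Z' := by ext1 <;> simp only [Prod.fst_add, Prod.snd_add] <;> ring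
  map_smul' a Z := by
    ext1 <;> simp only [Prod.smul_fst, Prod.smul_snd, smul_eq_mul, RingHom.id_apply] <;> ring

/-- Cayley–Hamilton: determinant 1, trace `X G ^ 2` in characteristic 2. -/
theorem dualLinear_sq (Z : PowerSeries (ZMod 2) × PowerSeries (ZMod 2)) :
    dualLinear (dualLinear Z) + Z = (X * geomSeries ^ 2) • dualLinear Z := by
  ext1
  · simp only [dualLinear, LinearMap.coe_mk, AddHom.coe_mk, Prod.fst_add, Prod.smul_fst,
      smul_eq_mul]
    linear_combination (Z.1 + X * geomSeries * (Z.2 + geomSeries * Z.1)) * series_two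
  · simp only [dualLinear, LinearMap.coe_mk, AddHom.coe_mk, Prod.snd_add, Prod.smul_snd,
      smul_eq_mul]
    linear_combination (Z.2 + geomSeries * Z.1) * series_two

/-- The action of a two-letter word on the coordinates of an alternating word. -/
noncomputable def dualAffine (y : ZMod 2) (Z : PowerSeries (ZMod 2) × PowerSeries (ZMod 2)) :
    PowerSeries (ZMod 2) × PowerSeries (ZMod 2) :=
  dualLinear Z + (X * geomSeries * (X * geomSeries ^ 2) + C y * geomSeries + X * geomSeries ^ 2,
    X * geomSeries ^ 2)

theorem wordTrans_wordTrans_seriesWord (n : ℕ)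
    (Z : PowerSeries (ZMod 2) × PowerSeries (ZMod 2)) (y : ZMod 2) :
    wordTrans (wordTrans (seriesWord n false Z.1 Z.2) (inputLetter 0)) (inputLetter y) =
      seriesWord n false (dualAffine y Z).1 (dualAffine y Z).2 := by
  rw [(wordTrans_seriesWord _ _ _ _).1, (wordTrans_seriesWord _ _ _ _).2]
  congr 1
  · simp only [dualAffine, dualLinear, LinearMap.coe_mk, AddHom.coe_mk, Prod.fst_add, map_zero]
    ring
  · simp only [dualAffine, dualLinear, LinearMap.coe_mk, AddHom.coe_mk, Prod.snd_add, map_zero]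
    ring

theorem dualAffine_one (Z : PowerSeries (ZMod 2) × PowerSeries (ZMod 2)) :
    dualAffine 1 Z = dualAffine 0 Z + (geomSeries, 0) := by
  ext1 <;> simp only [dualAffine, Prod.fst_add, Prod.snd_add, map_zero, map_one] <;> ring

theorem dualAffine_add (Z d : PowerSeries (ZMod 2) × PowerSeries (ZMod 2)) :
    dualAffine 0 (Z + d) = dualAffine 0 Z + dualLinear d := by
  simp only [dualAffine, map_add]
  abel

theorem dualAffine_iterate_add (j : ℕ) (Z d : PowerSeries (ZMod 2) × PowerSeries (ZMod 2)) :
    (dualAffine 0)^[j] (Z + d) = (dualAffine 0)^[j] Z + (dualLinear ^ j) d := by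
  induction j generalizing Z d with
  | zero => simp
  | succ j ih => rw [Function.iterate_succ_apply, Function.iterate_succ_apply, dualAffine_add, ih,
      pow_succ, Module.End.mul_apply]

/-- Modulo `X` the first row of the matrix is `(1, 0)`. -/
theorem constantCoeff_dualLinear_pow (j : ℕ)
    (Z : PowerSeries (ZMod 2) × PowerSeries (ZMod 2)) :
    constantCoeff ((dualLinear ^ j) Z).1 = constantCoeff Z.1 := by
  induction j with
  | zero => simp
  | succ j ih =>
    rw [pow_succ', Module.End.mul_apply, ← ih]
    simp [dualLinear]

/-- A coefficient functional vanishing on the orbit of a vector under the linear part of the dual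
action also vanishes on the powers of `L ^ 2 + 1` applied to the vector. -/
theorem coeff_dualLinear_smul_eq_zero {k : ℕ}
    {d : PowerSeries (ZMod 2) × PowerSeries (ZMod 2)}
    (h : ∀ j, coeff k (geomSeries * ((dualLinear ^ j) d).1) = 0) (i j : ℕ) :
    coeff k (geomSeries *
      ((dualLinear ^ j) ((X * geomSeries ^ 2) ^ i • (dualLinear ^ i) d)).1) = 0 := by
  induction i generalizing j with
  | zero => simpa using h j
  | succ i ih =>
    have key : (dualLinear ^ j) ((X * geomSeries ^ 2) ^ (i + 1) • (dualLinear ^ (i + 1)) d) =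
        (dualLinear ^ (j + 2)) ((X * geomSeries ^ 2) ^ i • (dualLinear ^ i) d) +
        (dualLinear ^ j) ((X * geomSeries ^ 2) ^ i • (dualLinear ^ i) d) := by
      rw [pow_add _ j 2, Module.End.mul_apply, ← map_add, pow_two dualLinear, Module.End.mul_apply,
        dualLinear_sq, map_smul dualLinear, pow_succ' dualLinear, Module.End.mul_apply, smul_smul,
        pow_succ']
    rw [key, Prod.fst_add, mul_add, map_add, ih, ih, add_zero]

theorem not_wordRun_seriesWord_eq (n : ℕ) (U V : PowerSeries (ZMod 2)) :
    ¬ ∀ u, wordRun (seriesWord (n + 1) false U V) u = u := by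
  intro h
  let T : Set (PowerSeries (ZMod 2) × PowerSeries (ZMod 2)) :=
    {Z | ∀ u, wordRun (seriesWord (n + 1) false Z.1 Z.2) u = u}
  have step (Z) (hZ : Z ∈ T) (y : ZMod 2) : dualAffine y Z ∈ T := fun u => by
    rw [← wordTrans_wordTrans_seriesWord]
    exact wordRun_wordTrans (wordRun_wordTrans hZ _) _ u
  have iter (j : ℕ) (Z) (hZ : Z ∈ T) : (dualAffine 0)^[j] Z ∈ T := by
    induction j with
    | zero => exact hZ
    | succ j ih => rw [Function.iterate_succ_apply']; exact step _ ih 0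
  obtain ⟨c, hc⟩ := wordOut_seriesWord n
  have const (Z) (hZ : Z ∈ T) : coeff (n / 2) (geomSeries * Z.1) + c = 0 := by
    have := (hc Z.1 Z.2 0).symm.trans (wordOut_eq hZ _)
    simpa using inputLetter_injective this
  -- Comparing the second letters `y = 0` and `y = 1` cancels the affine constants.
  have vanish (j : ℕ) : coeff (n / 2) (geomSeries * ((dualLinear ^ j) (geomSeries, 0)).1) = 0 := by
    have h0 := const _ (iter j _ (step (U, V) h 0))
    have h1 := const _ (iter j _ (step (U, V) h 1))
    rw [dualAffine_one, dualAffine_iterate_add, Prod.fst_add, mul_add, map_add] at h1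
    linear_combination h1 - h0
  -- The factor `X ^ (n / 2)` leaves only a constant coefficient, equal to 1.
  have := coeff_dualLinear_smul_eq_zero vanish (n / 2) 0
  rw [pow_zero, Module.End.one_apply, Prod.smul_fst, smul_eq_mul, mul_pow, mul_left_comm, mul_assoc,
    coeff_X_pow_mul'] at this
  simp [constantCoeff_dualLinear_pow, constantCoeff_geomSeries] at this

/-- A nonempty alternating word represents a nontrivial element. -/
theorem Alternating.elemH_ne_one {p : Bool} {v : List HState} (h : Alternating p v)
    (hv : v ≠ []) : elemH v ≠ 1 := by
  intro h1
  have hr := wordRun_eq_of_elemH_eq_one h1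
  obtain ⟨n, hn⟩ := Nat.exists_eq_succ_of_ne_zero (mt List.length_eq_zero_iff.1 hv)
  obtain ⟨U, V, rfl⟩ : ∃ U V, v = seriesWord (n + 1) p U V := by
    have := h.exists_seriesWord
    rwa [hn] at this
  cases p with
  | false => exact not_wordRun_seriesWord_eq n U V hr
  | true =>
    -- One section moves the word to class `false`.
    have hr' := wordRun_wordTrans hr (inputLetter 0)
    rw [(wordTrans_seriesWord _ _ _ _).2] at hr'
    exact not_wordRun_seriesWord_eq n _ _ hr'

/-! ### Forbidden blocks and the semigroup -/

theorem part_eq_not_of_notMem_forbidden {s t : HState} (h : [s, t] ∉ forbidden) :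
    t.part = !s.part := by
  cases s <;> cases t <;> simp_all [forbidden, part]

theorem alternating_of_forall_forbidden {s : HState} {v : List HState}
    (h : ∀ u ∈ forbidden, ¬ u <:+: s :: v) : Alternating s.part (s :: v) := by
  induction v generalizing s with
  | nil => exact ⟨rfl, trivial⟩
  | cons t v ih =>
    refine ⟨rfl, ?_⟩
    rw [← part_eq_not_of_notMem_forbidden fun hst => h [s, t] hst ⟨[], v, rfl⟩]
    exact ih fun u hu huv => h u hu (huv.trans (List.suffix_cons s _).isInfix)

/-- The generators `er` (for `true`) and `qr` (for `false`) of the semigroup. -/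
def semigroupBlock (b : Bool) : List HState := [if b then e else q, r]

theorem alternating_flatMap_semigroupBlock (l : List Bool) :
    Alternating false (l.flatMap semigroupBlock) := by
  induction l with
  | nil => trivial
  | cons b l ih => cases b <;> exact ⟨rfl, rfl, ih⟩

theorem exists_flatMap_semigroupBlock {g : groupH}
    (hg : g ∈ Subsemigroup.closure ({elemH [e, r], elemH [q, r]} : Set groupH)) :
    ∃ l : List Bool, l ≠ [] ∧ g = elemH (l.flatMap semigroupBlock) := by
  induction hg using Subsemigroup.closure_induction with
  | mem g hg =>
    rcases hg with rfl | rfl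
    · exact ⟨[true], by simp, rfl⟩
    · exact ⟨[false], by simp, rfl⟩
  | mul g g' _ _ ih ih' =>
    obtain ⟨l, hl, rfl⟩ := ih
    obtain ⟨l', _, rfl⟩ := ih'
    exact ⟨l ++ l', by simp [hl], by rw [List.flatMap_append, elemH_append]⟩

theorem ne_one_of_mem_closure {g : groupH}
    (hg : g ∈ Subsemigroup.closure ({elemH [e, r], elemH [q, r]} : Set groupH)) : g ≠ 1 := by
  obtain ⟨l, hl, rfl⟩ := exists_flatMap_semigroupBlock hg
  refine (alternating_flatMap_semigroupBlock l).elemH_ne_one ?_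
  cases l with
  | nil => exact absurd rfl hl
  | cons b l => simp [semigroupBlock]

/-- Each state permutes the alphabet by an involution. -/
theorem outEquiv_symm_apply (s : HState) (x : Fin 2) :
    (automaton.outEquiv automaton_invertible s).symm x = automaton.out s x := by
  rw [Equiv.symm_apply_eq]
  change x = automaton.out s (automaton.out s x)
  cases s <;> fin_cases x <;> rfl

theorem automaton_reversible : automaton.Reversible := by
  intro x
  constructor
  · intro s t h
    fin_cases x <;> cases s <;> cases t <;> first | rfl | cases h
  · intro t
    fin_cases x <;> cases t <;>
      first | exact ⟨q, rfl⟩ | exact ⟨w, rfl⟩ | exact ⟨e, rfl⟩ | exact ⟨r, rfl⟩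

theorem automaton_inverse_reversible :
    (automaton.inverse automaton_invertible).Reversible := by
  intro x
  have h : (automaton.inverse automaton_invertible).dual.out x =
      fun s => automaton.trans s (automaton.out s x) := by
    funext s
    simp only [MealyAutomaton.dual, MealyAutomaton.inverse, outEquiv_symm_apply]
  rw [h]
  constructor
  · intro s t h
    fin_cases x <;> cases s <;> cases t <;> first | rfl | cases h
  · intro t
    fin_cases x <;> cases t <;>
      first | exact ⟨q, rfl⟩ | exact ⟨w, rfl⟩ | exact ⟨e, rfl⟩ | exact ⟨r, rfl⟩

end HState

theorem proposition3p1 :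
    HState.automaton.Bireversible ∧
    (∀ v : List HState, v ≠ [] → (∀ u ∈ HState.forbidden, ¬ u <:+: v) →
      HState.elemH v ≠ 1) ∧
    (∀ g ∈ Subsemigroup.closure
        ({HState.elemH [.e, .r], HState.elemH [.q, .r]} : Set HState.groupH),
      ¬ IsOfFinOrder g) := by
  refine ⟨⟨HState.automaton_invertible, HState.automaton_reversible,
    HState.automaton_inverse_reversible⟩, fun v hv h => ?_, fun g hg hfin => ?_⟩
  · cases v with
    | nil => exact absurd rfl hv
    | cons s v => exact (HState.alternating_of_forall_forbidden h).elemH_ne_one hv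
  · obtain ⟨n, hn, h⟩ := isOfFinOrder_iff_pow_eq_one.1 hfin
    refine HState.ne_one_of_mem_closure ?_ h
    obtain ⟨n, rfl⟩ := Nat.exists_eq_succ_of_ne_zero hn.ne'
    clear hn h
    induction n with
    | zero => simpa using hg
    | succ n ih => rw [pow_succ]; exact mul_mem ih hg
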